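/- **Setting.** Let $\mathcal M$ be the set of $\sigma$-finite complex Borel measures on $\mathbb R^n$ (measures $d\mu=\theta\,d|\mu|$ with $|\mu|$ a $\sigma$-finite positive Borel measure and $|\theta|=1$). For $p\in[1,\infty]$ let $p'$ be the conjugate exponent, $\frac1p+\frac1{p'}=1$, and let $\widehat L^p=\{f\in L^p(\mathbb R^n): f=\widehat g \text{ for some } g\in L^{p'}(\mathbb R^n)\}$, where $\widehat g$ is the Fourier transform in the sense of distributions, normalized by $\widehat \psi(y)=\int \psi(x)e^{-2\pi i x\cdot y}\,dx$; put $\|f\|_{\widehat L^p}=\|\widehat f\,\|_{p'}$. For $\mu\in\mathcal M$ let $$\|\mu\|_p^*=\sup\Big\{\Big|\int h\,d\mu\Big| : h\in\widehat L^{p'},\ \|h\|_{\widehat L^{p'}}\le1\Big\}\in[0,\infty],$$ where $h$ runs over continuous functions (so that its integral against a measure that charges Lebesgue null sets makes sense), and $|\int h\,d\mu|$ is read as $\infty$ if $h$ is not $\mu$-integrable. For a Borel set $E$ let $\|\mu\|_{p,E}^*=\|\chi_E\mu\|_p^*$, and let $$\mathcal M_p=\{\mu:\|\mu\|_p^*<\infty\},\quad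 \mathcal M_{p,E}=\{\mu:\|\mu\|_{p,E}^*<\infty\},\quad \mathcal M_{1,loc}=\{\mu:\|\mu\|_{1,E}^*<\infty\text{ for every bounded Borel set }E\}.$$ For $1<s\le\infty$ let $C_s=\big\|\frac{\sin(\pi t)}{\pi t}\big\|_{L^s(\mathbb R)}$. **Statement.** 1. If $E\subset\mathbb R^n$ is a bounded Borel set and $1\le p\le r\le\infty$, then $\mathcal M_{r,E}\subset\mathcal M_{p,E}$. 2. Let $1\le p<r\le\infty$ and $\frac1q=\frac1p-\frac1r$. Then $C_{q'}\le\big(\frac{2q}{\pi}\big)^{1/q'}<\infty$, and for every $R>0$, every Borel set $E\subset[-R,R]^n$ and every $\mu\in\mathcal M$, $$\|\mu\|_{p,E}^*\le C_{q'}^{\,n}\,(2R)^{n/q}\,\|\mu\|_{r,E}^*.$$ 3. For every $p\in[1,\infty]$, $\mathcal M_p\subset\mathcal M_{1,loc}$. -/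

import Mathlib

open MeasureTheory
open scoped ENNReal FourierTransform SchwartzMap

namespace MeasLp

/-- The Euclidean space `ℝⁿ`. -/
abbrev Rn (n : ℕ) : Type := EuclideanSpace ℝ (Fin n)

/-- A sigma-finite complex Borel measure `μ` on `ℝⁿ`, given by its polar decomposition
`dμ = θ d|μ|`: the total variation `|μ|` is a sigma-finite positive Borel measure and `θ` is a
Borel function with `|θ| = 1`. The positive sigma-finite measures are those with `θ = 1`;
the measures need not be finite, nor locally finite. -/
structure SFMeasure (n : ℕ) where
  variation : Measure (Rn n)
  sigmaFinite : SigmaFinite variation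
  phase : Rn n → ℂ
  measurable_phase : Measurable phase
  norm_phase : ∀ x, ‖phase x‖ = 1

/-- The measure `χ_E μ`, that is `F ↦ ∫_F χ_E dμ` (for a measurable set `E`). -/
noncomputable def SFMeasure.restrict {n : ℕ} (μ : SFMeasure n) (E : Set (Rn n)) : SFMeasure n where
  variation := μ.variation.restrict E
  sigmaFinite := by
    have := μ.sigmaFinite
    infer_instance
  phase := μ.phase
  measurable_phase := μ.measurable_phase
  norm_phase := μ.norm_phase

/-- `|∫ h dμ|` as an element of `[0, ∞]`; it is `∞` if `h` is not `μ`-integrable. -/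
noncomputable def SFMeasure.absIntegral {n : ℕ} (μ : SFMeasure n) (h : Rn n → ℂ) : ℝ≥0∞ :=
  open Classical in
  if Integrable h μ.variation then ‖∫ x, h x * μ.phase x ∂μ.variation‖ₑ else ∞

/-- `f = ĝ` in the sense of tempered distributions: `∫ f ψ = ∫ g ψ̂` for all Schwartz `ψ`, where
`ψ̂(y) = ∫ ψ(x) exp(-2πi x·y) dx`. It is used for `f` and `g` in Lebesgue spaces. -/
def IsFourierOf {n : ℕ} (f g : Rn n → ℂ) : Prop :=
  ∀ ψ : 𝓢(Rn n, ℂ), ∫ x, f x * ψ x = ∫ x, g x * (𝓕 ψ) x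

/-- `f ∈ L̂^p(ℝⁿ)`: `f ∈ L^p` and `f = ĝ` for some `g ∈ L^{p'}`. -/
def MemHatLp {n : ℕ} (p : ℝ≥0∞) (f : Rn n → ℂ) : Prop :=
  MemLp f p ∧ ∃ g : Rn n → ℂ, MemLp g p.conjExponent ∧ IsFourierOf f g

/-- The norm `‖f‖_{L̂^p} = ‖f̂‖_{p'}`. If `f = ĝ` then `f̂(x) = g(-x)`, so this is `‖g‖_{p'}`;
such a `g` is unique up to null sets, and the infimum is over a single value. -/
noncomputable def hatLpNorm {n : ℕ} (p : ℝ≥0∞) (f : Rn n → ℂ) : ℝ≥0∞ :=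
  ⨅ (g : Rn n → ℂ) (_ : MemLp g p.conjExponent ∧ IsFourierOf f g), eLpNorm g p.conjExponent volume

/-- `‖μ‖_p^* = sup { |∫ h dμ| : h ∈ L̂^{p'}, ‖h‖_{L̂^{p'}} ≤ 1 }`. As `μ` may charge Lebesgue null
sets, `h` has to be a function and not a class of functions modulo null sets: the continuous
representatives are used. -/
noncomputable def SFMeasure.starNorm {n : ℕ} (μ : SFMeasure n) (p : ℝ≥0∞) : ℝ≥0∞ :=
  ⨆ (h : Rn n → ℂ) (_ : Continuous h ∧ MemHatLp p.conjExponent h ∧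
    hatLpNorm p.conjExponent h ≤ 1), μ.absIntegral h

/-- `‖μ‖_{p,E}^* = ‖χ_E μ‖_p^*`. -/
noncomputable def SFMeasure.starNormOn {n : ℕ} (μ : SFMeasure n) (p : ℝ≥0∞) (E : Set (Rn n)) :
    ℝ≥0∞ :=
  (μ.restrict E).starNorm p

/-- The space `M_p`. -/
def Mp (n : ℕ) (p : ℝ≥0∞) : Set (SFMeasure n) := {μ | μ.starNorm p < ∞}

/-- The space `M_{p,E}`. -/
def MpOn {n : ℕ} (p : ℝ≥0∞) (E : Set (Rn n)) : Set (SFMeasure n) := {μ | μ.starNormOn p E < ∞}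

/-- The space `M_{1,loc}`. -/
def M1loc (n : ℕ) : Set (SFMeasure n) :=
  {μ | ∀ E : Set (Rn n), MeasurableSet E → Bornology.IsBounded E → μ.starNormOn 1 E < ∞}

/-- The cube `[-R, R]ⁿ`. -/
def cube (n : ℕ) (R : ℝ) : Set (Rn n) := {x | ∀ i, x i ∈ Set.Icc (-R) R}

/-- The constant `C_s = ‖sin(π·)/(π·)‖_{L^s(ℝ)}`. -/
noncomputable def sincConst (s : ℝ≥0∞) : ℝ≥0∞ :=
  eLpNorm (fun t : ℝ => Real.sinc (Real.pi * t)) s volume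

end MeasLp

namespace MeasLp

/-! Let `k` be a test function for the exponent `p`, so `k` is the Fourier transform of some `g` in
`L^p`. On `E` it may be replaced by `k * 𝓕 a`, where `𝓕 a` is a smooth cutoff equal to 1 on the
cube. This product is the Fourier transform of the convolution `g * a` (`isFourierOf_mul_fourier`).
Since `1/p + 1/q' = 1 + 1/r`, Young's inequality bounds its `L^r` norm by `‖g‖_p ‖a‖_{q'}`, so after
normalization it is a test function for the exponent `r`.

The sharp characteristic function of the cube would give exactly the stated constant: its transform
is a product of dilated sinc functions. It is mollified at scale `ε` (`exists_cutoff`). Mollifying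
multiplies the transform by a factor of modulus at most 1, so the only cost is the larger half-side
`R + ε`, and `ε → 0` removes it. The inclusion for bounded sets follows.

For `M_{1,loc}`, a smooth cutoff is itself a multiple of a test function for every `p`. A finite
`‖μ‖_p^*` makes it integrable, so `|μ|` is finite on bounded sets. Test functions for the exponent 1
are transforms of `L^1` functions, hence bounded. -/

/-! ### The sinc constant -/

theorem abs_sinc_le_inv_abs {x : ℝ} (hx : x ≠ 0) : |Real.sinc x| ≤ |x|⁻¹ := by
  rw [Real.sinc_of_ne_zero hx, abs_div, div_eq_mul_inv]
  exact mul_le_of_le_one_left (by positivity) (Real.abs_sin_le_one x)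

theorem lintegral_Ioi_sinc_rpow_le {σ : ℝ} (hσ : 1 < σ) :
    ∫⁻ t in Set.Ioi (1 / Real.pi), ‖Real.sinc (Real.pi * t)‖ₑ ^ σ
      ≤ ENNReal.ofReal (1 / Real.pi * (σ - 1)⁻¹) := by
  have hπ := Real.pi_pos
  have ha : 0 < 1 / Real.pi := by positivity
  have hint := (integrableOn_Ioi_rpow_of_lt (a := -σ) (by linarith) ha).const_mul (Real.pi ^ (-σ))
  have hval : ∫ t in Set.Ioi (1 / Real.pi), Real.pi ^ (-σ) * t ^ (-σ)
      = 1 / Real.pi * (σ - 1)⁻¹ := by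
    rw [integral_const_mul, integral_Ioi_rpow_of_lt (by linarith) ha]
    have h1 : (1 / Real.pi) ^ (-σ + 1) = Real.pi ^ (σ - 1) := by
      rw [one_div, Real.inv_rpow hπ.le, ← Real.rpow_neg hπ.le]; congr 1; ring
    rw [h1, mul_div_assoc', mul_neg, ← Real.rpow_add hπ]
    have h2 : -σ + (σ - 1) = -1 := by ring
    have h3 : σ - 1 ≠ 0 := by linarith
    rw [h2, Real.rpow_neg_one, show -σ + 1 = -(σ - 1) by ring, neg_div_neg_eq]
    field_simp
  rw [← hval, ofReal_integral_eq_lintegral_ofReal hint]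
  · refine setLIntegral_mono' measurableSet_Ioi fun t ht => ?_
    have ht0 : 0 < t := ha.trans ht
    rw [← ofReal_norm, ENNReal.ofReal_rpow_of_nonneg (norm_nonneg _) (by linarith)]
    refine ENNReal.ofReal_le_ofReal ?_
    rw [← Real.mul_rpow hπ.le ht0.le, Real.rpow_neg (by positivity),
      ← Real.inv_rpow (by positivity)]
    refine Real.rpow_le_rpow (norm_nonneg _) ?_ (by linarith)
    have := abs_sinc_le_inv_abs (x := Real.pi * t) (by positivity)
    rwa [abs_of_pos (by positivity : 0 < Real.pi * t)] at this
  · filter_upwards [self_mem_ae_restrict measurableSet_Ioi] with t ht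
    have ht0 : 0 < t := ha.trans ht
    positivity

/-- The bounds `1` and `1/(π|t|)` for the integrand's base cross at `|t| = 1/π`. The middle interval
contributes `2/π`, and each of the two tails, equal by evenness, at most `(1/π)/(σ - 1)`. -/
theorem lintegral_sinc_rpow_le {σ : ℝ} (hσ : 1 < σ) :
    ∫⁻ t : ℝ, ‖Real.sinc (Real.pi * t)‖ₑ ^ σ
      ≤ ENNReal.ofReal (2 / Real.pi * (1 + (σ - 1)⁻¹)) := by
  have hπ := Real.pi_pos
  set a := 1 / Real.pi with ha
  set G : ℝ → ℝ≥0∞ := fun t => ‖Real.sinc (Real.pi * t)‖ₑ ^ σ with hG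
  have hI := lintegral_Ioi_sinc_rpow_le hσ
  have hneg : ∫⁻ t in Set.Iio (-a), G t = ∫⁻ t in Set.Ioi a, G t := by
    rw [← lintegral_indicator measurableSet_Iio, ← lintegral_indicator measurableSet_Ioi,
      ← lintegral_neg_eq_self]
    refine lintegral_congr fun t => ?_
    by_cases h : a < t
    · rw [Set.indicator_of_mem (by simpa using h), Set.indicator_of_mem (by simpa using h)]
      simp [hG, Real.sinc_neg]
    · rw [Set.indicator_of_notMem (by simpa using h), Set.indicator_of_notMem (by simpa using h)]
  have hmid : ∫⁻ t in Set.Icc (-a) a, G t ≤ ENNReal.ofReal (2 * a) := by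
    calc ∫⁻ t in Set.Icc (-a) a, G t ≤ ∫⁻ t in Set.Icc (-a) a, 1 := by
          refine lintegral_mono fun t => ENNReal.rpow_le_one ?_ (by linarith)
          rw [← ofReal_norm, ← ENNReal.ofReal_one]
          exact ENNReal.ofReal_le_ofReal (Real.abs_sinc_le_one _)
      _ = ENNReal.ofReal (2 * a) := by
          rw [setLIntegral_one, Real.volume_Icc]; congr 1; ring
  have hcover : (Set.univ : Set ℝ) ⊆ Set.Iio (-a) ∪ (Set.Icc (-a) a ∪ Set.Ioi a) := by
    intro t _
    simp only [Set.mem_union, Set.mem_Iio, Set.mem_Icc, Set.mem_Ioi]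
    by_cases h : t < -a
    · exact Or.inl h
    · by_cases h' : a < t
      · exact Or.inr (Or.inr h')
      · exact Or.inr (Or.inl ⟨not_lt.1 h, not_lt.1 h'⟩)
  have hσ' : 0 < (σ - 1)⁻¹ := inv_pos.2 (by linarith)
  have ha0 : 0 < a := by positivity
  calc ∫⁻ t, G t = ∫⁻ t in Set.univ, G t := by rw [setLIntegral_univ]
    _ ≤ ∫⁻ t in Set.Iio (-a) ∪ (Set.Icc (-a) a ∪ Set.Ioi a), G t := lintegral_mono_set hcover
    _ ≤ (∫⁻ t in Set.Iio (-a), G t) +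
          ((∫⁻ t in Set.Icc (-a) a, G t) + ∫⁻ t in Set.Ioi a, G t) :=
        (lintegral_union_le _ _ _).trans (add_le_add le_rfl (lintegral_union_le _ _ _))
    _ ≤ ENNReal.ofReal (a * (σ - 1)⁻¹) +
          (ENNReal.ofReal (2 * a) + ENNReal.ofReal (a * (σ - 1)⁻¹)) := by
        exact add_le_add (hneg.trans_le hI) (add_le_add hmid hI)
    _ = ENNReal.ofReal (2 / Real.pi * (1 + (σ - 1)⁻¹)) := by
        rw [← ENNReal.ofReal_add (by positivity) (by positivity),
          ← ENNReal.ofReal_add (by positivity) (by positivity)]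
        congr 1; rw [ha]; ring

theorem sincConst_top_le : sincConst ∞ ≤ 1 := by
  rw [sincConst, eLpNorm_exponent_top]
  refine eLpNormEssSup_le_of_ae_enorm_bound (Filter.Eventually.of_forall fun t => ?_)
  rw [← ofReal_norm, ← ENNReal.ofReal_one]
  exact ENNReal.ofReal_le_ofReal (Real.abs_sinc_le_one _)

theorem sincConst_conjExponent_le {q : ℝ≥0∞} (hq : 1 ≤ q) (hq' : q ≠ ∞) :
    sincConst q.conjExponent
      ≤ ENNReal.ofReal ((2 * q.toReal / Real.pi) ^ (1 - 1 / q.toReal)) := by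
  -- For `q = 1` the conjugate exponent is `∞` and the right side is a zeroth power, so the bound is
  -- `|sinc| ≤ 1`.
  rcases eq_or_ne q 1 with rfl | hq1
  · simpa [ENNReal.conjExponent] using sincConst_top_le
  have hq1' : 1 < q.toReal := by
    have : 1 < q := lt_of_le_of_ne hq hq1.symm
    simpa using (ENNReal.toReal_lt_toReal ENNReal.one_ne_top hq').2 this
  have hqs : q.toReal - 1 ≠ 0 := by linarith
  have hc : q.conjExponent = ENNReal.ofReal (1 + (q.toReal - 1)⁻¹) := by
    have h0 : q - 1 = ENNReal.ofReal (q.toReal - 1) := by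
      rw [ENNReal.ofReal_sub _ zero_le_one, ENNReal.ofReal_toReal hq', ENNReal.ofReal_one]
    rw [ENNReal.conjExponent, h0, ← ENNReal.ofReal_inv_of_pos (by linarith),
      ENNReal.ofReal_add zero_le_one (inv_nonneg.2 (by linarith)), ENNReal.ofReal_one]
  set σ := 1 + (q.toReal - 1)⁻¹ with hσ
  have hσ1 : 1 < σ := by
    have : 0 < (q.toReal - 1)⁻¹ := inv_pos.2 (by linarith)
    linarith
  rw [sincConst, hc, eLpNorm_eq_lintegral_rpow_enorm_toReal
    (by simpa using by linarith) ENNReal.ofReal_ne_top, ENNReal.toReal_ofReal (by linarith)]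
  have he : 1 / σ = 1 - 1 / q.toReal := by
    have : q.toReal ≠ 0 := by linarith
    rw [hσ]; field_simp; ring_nf; exact mul_inv_cancel₀ this
  -- Here `σ = q'`, and `1 + 1/(σ - 1)` is its conjugate `q`.
  have hv : 2 / Real.pi * (1 + (σ - 1)⁻¹) = 2 * q.toReal / Real.pi := by
    rw [hσ]; simp; ring
  have hpos : 0 < 1 / σ := by positivity
  rw [← he, ← ENNReal.ofReal_rpow_of_nonneg (by positivity) hpos.le, ← hv]
  exact ENNReal.rpow_le_rpow (lintegral_sinc_rpow_le hσ1) hpos.le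

/-! ### Young's convolution inequality -/

section Young

variable {G : Type*} [MeasurableSpace G] [AddCommGroup G] [MeasurableAdd₂ G] [MeasurableNeg G]
  {μ : Measure G} [μ.IsAddLeftInvariant] [μ.IsNegInvariant]

/-- Young's convolution inequality for the target exponent `∞`. -/
theorem lintegral_enorm_mul_enorm_sub_le {p s : ℝ≥0∞} [hps : p.HolderConjugate s] {g a : G → ℂ}
    (hg : AEStronglyMeasurable g μ) (ha : AEStronglyMeasurable a μ) (y : G) :
    ∫⁻ x, ‖g x‖ₑ * ‖a (y - x)‖ₑ ∂μ ≤ eLpNorm g p μ * eLpNorm a s μ := by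
  have hmp := Measure.measurePreserving_sub_left μ y
  have h := eLpNorm_smul_le_mul_eLpNorm (r := 1) (p := p) (q := s)
    (ha.comp_measurePreserving hmp) hg
  rw [eLpNorm_comp_measurePreserving ha hmp, eLpNorm_one_eq_lintegral_enorm] at h
  simpa [enorm_smul] using h

theorem lintegral_enorm_rpow_eq_eLpNorm_rpow {α : Type*} [MeasurableSpace α] {ν : Measure α}
    {p : ℝ≥0∞}    (hp : p ≠ 0) (hp' : p ≠ ∞) (g : α → ℂ) :
    ∫⁻ x, ‖g x‖ₑ ^ p.toReal ∂ν = eLpNorm g p ν ^ p.toReal := by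
  have := ENNReal.toReal_pos hp hp'
  rw [eLpNorm_eq_lintegral_rpow_enorm_toReal hp hp', ← ENNReal.rpow_mul,
    one_div_mul_cancel this.ne', ENNReal.rpow_one]

/-- Hölder with the three weights `1/r`, `1/p - 1/r`, `1/s - 1/r`, which sum to 1, applied to `|g|^p
|a|^s`, `|g|^p`, `|a|^s`. Only the first factor couples `g` and `a`; integrating it in `y` gives
Young's inequality. -/
theorem lintegral_enorm_mul_enorm_sub_rpow_le {p s r : ℝ} (hp : 1 ≤ p) (hs : 1 ≤ s) (hr : 0 < r)
    (hprs : 1 / p + 1 / s = 1 + 1 / r) {g a : G → ℂ}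
    (hg : AEStronglyMeasurable g μ) (ha : AEStronglyMeasurable a μ) (y : G) :
    (∫⁻ x, ‖g x‖ₑ * ‖a (y - x)‖ₑ ∂μ) ^ r ≤
      (∫⁻ x, ‖g x‖ₑ ^ p * ‖a (y - x)‖ₑ ^ s ∂μ) * (∫⁻ x, ‖g x‖ₑ ^ p ∂μ) ^ (r / p - 1) *
        (∫⁻ x, ‖a x‖ₑ ^ s ∂μ) ^ (r / s - 1) := by
  have hmp := Measure.measurePreserving_sub_left μ y
  have hp0 : 0 < p := by linarith
  have hs0 : 0 < s := by linarith
  have hgm := hg.enorm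
  have ham := (ha.comp_measurePreserving hmp).enorm
  have hp1 : 1 / p ≤ 1 := by rw [div_le_one hp0]; exact hp
  have hs1 : 1 / s ≤ 1 := by rw [div_le_one hs0]; exact hs
  have hr0 : 0 < 1 / r := by positivity
  have key := ENNReal.lintegral_prod_norm_pow_le (μ := μ) Finset.univ
    (f := ![fun x => ‖g x‖ₑ ^ p * ‖a (y - x)‖ₑ ^ s, fun x => ‖g x‖ₑ ^ p,
      fun x => ‖a (y - x)‖ₑ ^ s])
    (p := ![1 / r, 1 / p - 1 / r, 1 / s - 1 / r])
    (by
      intro i _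
      fin_cases i
      · exact (hgm.pow_const p).mul (ham.pow_const s)
      · exact hgm.pow_const p
      · exact ham.pow_const s)
    (by simp [Fin.sum_univ_three] at hprs ⊢; linarith)
    (by
      intro i _
      fin_cases i
      · exact hr0.le
      · simp at *; linarith
      · simp at *; linarith)
  simp only [Fin.prod_univ_three, Matrix.cons_val_zero, Matrix.cons_val_one,
    Matrix.cons_val] at key
  have hpt : ∀ x, (‖g x‖ₑ ^ p * ‖a (y - x)‖ₑ ^ s) ^ (1 / r) * (‖g x‖ₑ ^ p) ^ (1 / p - 1 / r) *
      (‖a (y - x)‖ₑ ^ s) ^ (1 / s - 1 / r) = ‖g x‖ₑ * ‖a (y - x)‖ₑ := by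
    intro x
    rw [ENNReal.mul_rpow_of_nonneg _ _ hr0.le]
    have h1 : ∀ (u : ℝ≥0∞) (t : ℝ), 0 < t → 0 ≤ 1 / t - 1 / r →
        (u ^ t) ^ (1 / r) * (u ^ t) ^ (1 / t - 1 / r) = u := by
      intro u t ht h
      rw [← ENNReal.rpow_add_of_nonneg _ _ hr0.le h, ← ENNReal.rpow_mul]
      rw [show t * (1 / r + (1 / t - 1 / r)) = 1 by field_simp; ring, ENNReal.rpow_one]
    calc _ = ((‖g x‖ₑ ^ p) ^ (1 / r) * (‖g x‖ₑ ^ p) ^ (1 / p - 1 / r)) *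
          ((‖a (y - x)‖ₑ ^ s) ^ (1 / r) * (‖a (y - x)‖ₑ ^ s) ^ (1 / s - 1 / r)) := by ring
      _ = _ := by rw [h1 _ p hp0 (by linarith), h1 _ s hs0 (by linarith)]
  simp only [hpt] at key
  have hshift : ∫⁻ x, ‖a (y - x)‖ₑ ^ s ∂μ = ∫⁻ x, ‖a x‖ₑ ^ s ∂μ :=
    lintegral_sub_left_eq_self (fun x => ‖a x‖ₑ ^ s) y
  rw [hshift] at key
  calc _ ≤ _ := ENNReal.rpow_le_rpow key hr.le
    _ = _ := by
      rw [ENNReal.mul_rpow_of_nonneg _ _ hr.le, ENNReal.mul_rpow_of_nonneg _ _ hr.le,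
        ← ENNReal.rpow_mul, ← ENNReal.rpow_mul, ← ENNReal.rpow_mul, one_div_mul_cancel hr.ne',
        ENNReal.rpow_one]
      congr 3 <;> field_simp

/-- **Young's convolution inequality**. -/
theorem eLpNorm_convolution_le [SFinite μ] {p s r : ℝ≥0∞} (hp : 1 ≤ p) (hs : 1 ≤ s)
    (hprs : p⁻¹ + s⁻¹ = 1 + r⁻¹) {g a : G → ℂ}
    (hg : AEStronglyMeasurable g μ) (ha : AEStronglyMeasurable a μ) :
    eLpNorm (fun y => ∫ x, g x * a (y - x) ∂μ) r μ ≤ eLpNorm g p μ * eLpNorm a s μ := by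
  have hle : ∀ y, ‖∫ x, g x * a (y - x) ∂μ‖ₑ ≤ ∫⁻ x, ‖g x‖ₑ * ‖a (y - x)‖ₑ ∂μ := fun y =>
    (enorm_integral_le_lintegral_enorm _).trans_eq (by simp only [enorm_mul])
  rcases eq_or_ne r ∞ with rfl | hr
  · have : p.HolderConjugate s := ⟨by simpa using hprs⟩
    rw [eLpNorm_exponent_top]
    exact eLpNormEssSup_le_of_ae_enorm_bound (Filter.Eventually.of_forall fun y =>
      (hle y).trans (lintegral_enorm_mul_enorm_sub_le hg ha y))
  have hp0 : p ≠ 0 := (zero_lt_one.trans_le hp).ne'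
  have hs0 : s ≠ 0 := (zero_lt_one.trans_le hs).ne'
  have hpi : p⁻¹ ≤ 1 := ENNReal.inv_le_one.2 hp
  have hsi : s⁻¹ ≤ 1 := ENNReal.inv_le_one.2 hs
  have hri : 1 < 1 + r⁻¹ := ENNReal.lt_add_right ENNReal.one_ne_top (ENNReal.inv_ne_zero.2 hr)
  -- With `r` finite the right side of the exponent relation exceeds 1, so neither `1/p` nor `1/s`
  -- can vanish.
  have hp' : p ≠ ∞ := by
    rintro rfl
    simp only [ENNReal.inv_top, zero_add] at hprs
    exact absurd (hprs ▸ hsi) (not_le.2 hri)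
  have hs' : s ≠ ∞ := by
    rintro rfl
    simp only [ENNReal.inv_top, add_zero] at hprs
    exact absurd (hprs ▸ hpi) (not_le.2 hri)
  have hr0 : r ≠ 0 := by
    rintro rfl
    rw [ENNReal.inv_zero, add_top] at hprs
    exact (ENNReal.add_lt_top.2 ⟨hpi.trans_lt ENNReal.one_lt_top,
      hsi.trans_lt ENNReal.one_lt_top⟩).ne hprs
  have hrr := ENNReal.toReal_pos hr0 hr
  have hpr := ENNReal.toReal_pos hp0 hp'
  have hsr := ENNReal.toReal_pos hs0 hs'
  have hp1 : 1 ≤ p.toReal := by simpa using ENNReal.toReal_mono hp' hp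
  have hs1 : 1 ≤ s.toReal := by simpa using ENNReal.toReal_mono hs' hs
  have hreal : 1 / p.toReal + 1 / s.toReal = 1 + 1 / r.toReal := by
    have := congrArg ENNReal.toReal hprs
    rw [ENNReal.toReal_add (ENNReal.inv_ne_top.2 hp0) (ENNReal.inv_ne_top.2 hs0),
      ENNReal.toReal_add ENNReal.one_ne_top (ENNReal.inv_ne_top.2 hr0)] at this
    simpa using this
  have hpe : 0 ≤ r.toReal / p.toReal - 1 := by
    have h1 : 1 / s.toReal ≤ 1 := by rw [div_le_one hsr]; exact hs1
    have h2 : 0 ≤ r.toReal * (1 / p.toReal - 1 / r.toReal) := mul_nonneg hrr.le (by linarith)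
    have h3 : r.toReal * (1 / p.toReal - 1 / r.toReal) = r.toReal / p.toReal - 1 := by field_simp
    linarith
  have hse : 0 ≤ r.toReal / s.toReal - 1 := by
    have h1 : 1 / p.toReal ≤ 1 := by rw [div_le_one hpr]; exact hp1
    have h2 : 0 ≤ r.toReal * (1 / s.toReal - 1 / r.toReal) := mul_nonneg hrr.le (by linarith)
    have h3 : r.toReal * (1 / s.toReal - 1 / r.toReal) = r.toReal / s.toReal - 1 := by field_simp
    linarith
  set A := ∫⁻ x, ‖g x‖ₑ ^ p.toReal ∂μ with hA
  set B := ∫⁻ x, ‖a x‖ₑ ^ s.toReal ∂μ with hB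
  have hsub : Measure.QuasiMeasurePreserving (fun z : G × G => z.1 - z.2) (μ.prod μ) μ :=
    quasiMeasurePreserving_sub_of_right_invariant μ μ
  have hmeas : AEMeasurable (Function.uncurry fun y x => ‖g x‖ₑ ^ p.toReal *
      ‖a (y - x)‖ₑ ^ s.toReal) (μ.prod μ) :=
    ((hg.comp_snd).enorm.pow_const _).mul
      ((ha.comp_quasiMeasurePreserving hsub).enorm.pow_const _)
  -- Tonelli and translation invariance decouple the two functions.
  have hdouble : ∫⁻ y, ∫⁻ x, ‖g x‖ₑ ^ p.toReal * ‖a (y - x)‖ₑ ^ s.toReal ∂μ ∂μ = A * B := by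
    rw [lintegral_lintegral_swap hmeas]
    have : ∀ x, ∫⁻ y, ‖g x‖ₑ ^ p.toReal * ‖a (y - x)‖ₑ ^ s.toReal ∂μ
        = ‖g x‖ₑ ^ p.toReal * B := by
      intro x
      refine (lintegral_const_mul'' _ ((ha.comp_measurePreserving
        (measurePreserving_sub_right μ x)).enorm.pow_const _)).trans ?_
      congr 1
      exact lintegral_sub_right_eq_self (fun y => ‖a y‖ₑ ^ s.toReal) x
    simp only [this]
    rw [lintegral_mul_const'' _ (hg.enorm.pow_const _)]
  have hmeas' : AEMeasurable (fun y => ∫⁻ x, ‖g x‖ₑ ^ p.toReal * ‖a (y - x)‖ₑ ^ s.toReal ∂μ) μ :=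
    hmeas.lintegral_prod_right'
  have hfin : ∫⁻ y, ‖∫ x, g x * a (y - x) ∂μ‖ₑ ^ r.toReal ∂μ
      ≤ (eLpNorm g p μ * eLpNorm a s μ) ^ r.toReal := by
    calc _ ≤ ∫⁻ y, (∫⁻ x, ‖g x‖ₑ ^ p.toReal * ‖a (y - x)‖ₑ ^ s.toReal ∂μ) *
            (A ^ (r.toReal / p.toReal - 1) * B ^ (r.toReal / s.toReal - 1)) ∂μ := by
          refine lintegral_mono fun y => (ENNReal.rpow_le_rpow (hle y) hrr.le).trans ?_
          rw [← mul_assoc]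
          exact lintegral_enorm_mul_enorm_sub_rpow_le hp1 hs1 hrr hreal hg ha y
      _ = A * B * (A ^ (r.toReal / p.toReal - 1) * B ^ (r.toReal / s.toReal - 1)) := by
          rw [lintegral_mul_const'' _ hmeas', hdouble]
      _ = (A ^ (1 : ℝ) * A ^ (r.toReal / p.toReal - 1)) *
            (B ^ (1 : ℝ) * B ^ (r.toReal / s.toReal - 1)) := by
          rw [ENNReal.rpow_one, ENNReal.rpow_one]; ring
      _ = A ^ (r.toReal / p.toReal) * B ^ (r.toReal / s.toReal) := by
          rw [← ENNReal.rpow_add_of_nonneg _ _ zero_le_one hpe,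
            ← ENNReal.rpow_add_of_nonneg _ _ zero_le_one hse]
          congr 2 <;> ring
      _ = _ := by
          rw [hA, hB, lintegral_enorm_rpow_eq_eLpNorm_rpow hp0 hp',
            lintegral_enorm_rpow_eq_eLpNorm_rpow hs0 hs',
            ← ENNReal.rpow_mul, ← ENNReal.rpow_mul, mul_div_cancel₀ _ hpr.ne',
            mul_div_cancel₀ _ hsr.ne', ENNReal.mul_rpow_of_nonneg _ _ hrr.le]
  rw [eLpNorm_eq_lintegral_rpow_enorm_toReal hr0 hr]
  refine (ENNReal.rpow_le_rpow hfin (by positivity)).trans_eq ?_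
  rw [← ENNReal.rpow_mul, mul_one_div_cancel hrr.ne', ENNReal.rpow_one]

end Young

/-! ### Transform of a cube and the smooth cutoff -/

theorem integral_Icc_cexp {ρ : ℝ} (hρ : 0 ≤ ρ) (ξ : ℝ) :
    ∫ t in Set.Icc (-ρ) ρ, Complex.exp (-(2 * Real.pi * t * ξ) * Complex.I)
      = (2 * ρ * Real.sinc (Real.pi * (2 * ρ * ξ)) : ℝ) := by
  rw [integral_Icc_eq_integral_Ioc, ← intervalIntegral.integral_of_le (by linarith)]
  rcases eq_or_ne ξ 0 with rfl | hξ
  · simp; ring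
  rcases hρ.eq_or_lt with rfl | hρ
  · simp
  have hπ := Real.pi_pos.ne'
  set c : ℂ := -(2 * Real.pi * ξ) * Complex.I with hc
  have hπ' : (Real.pi : ℂ) ≠ 0 := by exact_mod_cast hπ
  have hξ' : (ξ : ℂ) ≠ 0 := by exact_mod_cast hξ
  have hρ' : (ρ : ℂ) ≠ 0 := by exact_mod_cast hρ.ne'
  have hc0 : c ≠ 0 := by simp [hc, hπ', hξ']
  have h1 : ∀ t : ℝ, -(2 * Real.pi * t * ξ) * Complex.I = c * (t : ℂ) := by
    intro t; rw [hc]; ring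
  simp only [h1]
  rw [integral_exp_mul_complex hc0, Real.sinc_of_ne_zero (by positivity)]
  push_cast
  rw [Complex.sin]
  have e1 : c * (ρ : ℂ) = -(Real.pi * (2 * ρ * ξ)) * Complex.I := by rw [hc]; ring
  have e2 : c * (-(ρ : ℂ)) = (Real.pi * (2 * ρ * ξ)) * Complex.I := by rw [hc]; ring
  rw [e1, e2, hc]
  field_simp
  ring_nf
  simp [Complex.I_sq]

theorem isClosed_cube (n : ℕ) (R : ℝ) : IsClosed (cube n R) := by
  have : cube n R = ⋂ i, (fun x : Rn n => x i) ⁻¹' Set.Icc (-R) R := by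
    ext x; simp [cube]
  rw [this]
  exact isClosed_iInter fun i => isClosed_Icc.preimage (by fun_prop)

theorem isBounded_cube (n : ℕ) (R : ℝ) : Bornology.IsBounded (cube n R) := by
  have h : (cube n R) = (WithLp.ofLp : Rn n → (Fin n → ℝ)) ⁻¹'
      (Set.Icc (fun _ => -R) fun _ => R) := by
    ext x; simp [cube, Pi.le_def, forall_and]
  rw [h]
  exact (PiLp.antilipschitzWith_ofLp 2 fun _ : Fin n => ℝ).isBounded_preimage
    (Metric.isBounded_Icc _ _)

theorem fourier_indicator_cube (n : ℕ) {ρ : ℝ} (hρ : 0 ≤ ρ) (ξ : Rn n) :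
    𝓕 ((cube n ρ).indicator fun _ => (1 : ℂ)) ξ
      = ∏ i, ((2 * ρ * Real.sinc (Real.pi * (2 * ρ * ξ i)) : ℝ) : ℂ) := by
  have hpt : ∀ x : Rn n, Complex.exp ((-2 * Real.pi * inner ℝ x ξ : ℝ) * Complex.I) •
      (cube n ρ).indicator (fun _ => (1 : ℂ)) x
      = ∏ i, (Set.Icc (-ρ) ρ).indicator
          (fun t : ℝ => Complex.exp (-(2 * Real.pi * t * ξ i) * Complex.I)) (x i) := by
    intro x
    by_cases hx : x ∈ cube n ρ
    · rw [Set.indicator_of_mem hx, smul_eq_mul, mul_one]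
      rw [Finset.prod_congr rfl fun i _ => Set.indicator_of_mem (hx i) _, ← Complex.exp_sum]
      congr 1
      rw [PiLp.inner_apply]
      push_cast
      rw [Finset.mul_sum, Finset.sum_mul]
      refine Finset.sum_congr rfl fun i _ => ?_
      simp
      ring
    · rw [Set.indicator_of_notMem hx, smul_zero]
      have : ∃ i, x i ∉ Set.Icc (-ρ) ρ := by simpa only [cube, Set.mem_ofPred_eq, not_forall] using hx
      obtain ⟨i, hi⟩ := this
      exact (Finset.prod_eq_zero (Finset.mem_univ i) (Set.indicator_of_notMem hi _)).symm
  rw [Real.fourier_eq']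
  simp only [hpt]
  have := (PiLp.volume_preserving_ofLp (Fin n)).integral_comp
    (MeasurableEquiv.toLp 2 (Fin n → ℝ)).symm.measurableEmbedding
    (fun y : Fin n → ℝ => ∏ i, (Set.Icc (-ρ) ρ).indicator
      (fun t : ℝ => Complex.exp (-(2 * Real.pi * t * ξ i) * Complex.I)) (y i))
  rw [this, integral_fintype_prod_volume_eq_prod (fun i => (Set.Icc (-ρ) ρ).indicator
      (fun t : ℝ => Complex.exp (-(2 * Real.pi * t * ξ i) * Complex.I)))]
  refine Finset.prod_congr rfl fun i _ => ?_
  rw [integral_indicator measurableSet_Icc]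
  exact integral_Icc_cexp hρ (ξ i)

/-- A smooth cutoff of the cube `[-R, R]ⁿ` whose inverse Fourier transform is dominated by that of
the indicator function of a slightly larger cube. -/
theorem exists_cutoff (n : ℕ) {R ε : ℝ} (hR : 0 ≤ R) (hε : 0 < ε) :
    ∃ a : 𝓢(Rn n, ℂ), HasCompactSupport (𝓕 a : 𝓢(Rn n, ℂ)) ∧
      (∀ x ∈ cube n R, (𝓕 a : 𝓢(Rn n, ℂ)) x = 1) ∧
      ∀ ξ, ‖a ξ‖ ≤ ∏ i, |2 * (R + ε) * Real.sinc (Real.pi * (2 * (R + ε) * ξ i))| := by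
  -- The outer radius `ε` is what keeps the ball about any point of the cube of half-side `R` inside
  -- the one of half-side `R + ε`, so averaging leaves the value 1 there.
  let b : ContDiffBump (0 : Rn n) := ⟨ε / 2, ε, by positivity, by linarith⟩
  let η : Rn n → ℂ := fun x => (b.normed volume x : ℂ)
  let χ : Rn n → ℂ := (cube n (R + ε)).indicator fun _ => 1
  have hηs : HasCompactSupport η := b.hasCompactSupport_normed.comp_left Complex.ofReal_zero
  have hηc : ContDiff ℝ (⊤ : ℕ∞) η := Complex.ofRealCLM.contDiff.comp b.contDiff_normed
  have hηi : Integrable η := hηc.continuous.integrable_of_hasCompactSupport hηs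
  have hcm : MeasurableSet (cube n (R + ε)) := (isClosed_cube n _).measurableSet
  have hχi : Integrable χ :=
    (integrable_indicator_iff hcm).2
      (integrableOn_const (isBounded_cube n _).measure_lt_top.ne enorm_ne_top)
  let φ : Rn n → ℂ := convolution η χ (ContinuousLinearMap.mul ℂ ℂ) volume
  have hφs : HasCompactSupport φ :=
    hηs.convolution (L := ContinuousLinearMap.mul ℂ ℂ)
      ((Metric.isCompact_of_isClosed_isBounded (isClosed_cube n _)
        (isBounded_cube n _)).of_isClosed_subset
        (isClosed_tsupport _) (closure_minimal Set.support_indicator_subset (isClosed_cube n _)))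
  -- Smoothness of the convolution is a statement over `ℝ`, the convolution theorem one over `ℂ`;
  -- both describe the same function.
  have hφR : φ = convolution η χ ((ContinuousLinearMap.mul ℝ ℂ)) volume := rfl
  have hφc : ContDiff ℝ (⊤ : ℕ∞) φ := by
    rw [hφR]
    exact hηs.contDiff_convolution_left _ hηc hχi.locallyIntegrable
  let Φ : 𝓢(Rn n, ℂ) := hφs.toSchwartzMap hφc
  have hΦ : ∀ x, Φ x = φ x := fun x => rfl
  refine ⟨𝓕⁻ Φ, ?_, ?_, ?_⟩
  · rw [FourierTransform.fourier_fourierInv_eq]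
    exact hφs
  · intro x hx
    rw [FourierTransform.fourier_fourierInv_eq, hΦ]
    have h1 : φ x = convolution (b.normed volume) χ (ContinuousLinearMap.lsmul ℝ ℝ) volume x := by
      simp [φ, convolution, η]
    rw [h1, b.normed_convolution_eq_right (g := χ) (x₀ := x)]
    · exact Set.indicator_of_mem (fun i => ⟨by linarith [(hx i).1], by linarith [(hx i).2]⟩) _
    · intro y hy
      have hy' : y ∈ cube n (R + ε) := by
        intro i
        have h2 : |(y - x) i| ≤ ‖y - x‖ := PiLp.norm_apply_le (y - x) i
        have h3 : ‖y - x‖ < ε := by simpa [dist_eq_norm] using hy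
        have h4 := abs_le.1 (h2.trans h3.le)
        simp only [PiLp.sub_apply] at h4
        exact ⟨by linarith [(hx i).1], by linarith [(hx i).2]⟩
      have hx' : x ∈ cube n (R + ε) :=
        fun i => ⟨by linarith [(hx i).1], by linarith [(hx i).2]⟩
      simp [χ, hy', hx']
  · intro ξ
    have h1 : (𝓕⁻ Φ) ξ = 𝓕 η (-ξ) * 𝓕 χ (-ξ) := by
      rw [SchwartzMap.fourierInv_coe, Real.fourierInv_eq_fourier_neg,
        ← Real.fourier_mul_convolution_eq hηi hχi]
      rfl
    -- The mollifier is a probability density.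
    have h2 : ‖𝓕 η (-ξ)‖ ≤ 1 := by
      refine (VectorFourier.norm_fourierIntegral_le_integral_norm _ _ _ _ _).trans_eq ?_
      rw [← b.integral_normed (μ := volume)]
      refine integral_congr_ae (Filter.Eventually.of_forall fun x => ?_)
      simp only [η, Complex.norm_real]
      exact abs_of_nonneg (b.nonneg_normed x)
    rw [h1, norm_mul, fourier_indicator_cube n (by positivity)]
    refine (mul_le_of_le_one_left (norm_nonneg _) h2).trans_eq ?_
    rw [norm_prod]
    refine Finset.prod_congr rfl fun i _ => ?_
    rw [Complex.norm_real, Real.norm_eq_abs]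
    simp [Real.sinc_neg]

/-! ### The norm of the cutoff's majorant -/

theorem eLpNorm_prod_coord_le (n : ℕ) {s : ℝ≥0∞} (hs : 1 ≤ s) {f : ℝ → ℝ} (hf : MemLp f s) :
    eLpNorm (fun ξ : Rn n => ∏ i, |f (ξ i)|) s volume ≤ eLpNorm f s volume ^ n := by
  have hmp := PiLp.volume_preserving_ofLp (Fin n)
  rcases eq_or_ne s ∞ with rfl | hs'
  · rw [eLpNorm_exponent_top, eLpNorm_exponent_top]
    refine eLpNormEssSup_le_of_ae_enorm_bound ?_
    have h1 : ∀ i : Fin n, ∀ᵐ ξ : Rn n, ‖f (ξ i)‖ₑ ≤ eLpNormEssSup f volume := fun i =>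
      ((Measure.quasiMeasurePreserving_eval (fun _ : Fin n => (volume : Measure ℝ)) i).comp
        hmp.quasiMeasurePreserving).ae (enorm_ae_le_eLpNormEssSup f volume)
    filter_upwards [Filter.eventually_all.2 h1] with ξ hξ
    calc ‖∏ i, |f (ξ i)|‖ₑ = ∏ i, ‖f (ξ i)‖ₑ := by
          simp_rw [← ofReal_norm, norm_prod, Real.norm_eq_abs, abs_abs]
          rw [ENNReal.ofReal_prod_of_nonneg fun _ _ => abs_nonneg _]
      _ ≤ ∏ _i : Fin n, eLpNormEssSup f volume := Finset.prod_le_prod' fun i _ => hξ i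
      _ = _ := by simp
  · have hs0 : s ≠ 0 := (zero_lt_one.trans_le hs).ne'
    have hsr := ENNReal.toReal_pos hs0 hs'
    have hint : Integrable fun t => |f t| ^ s.toReal := hf.integrable_norm_rpow hs0 hs'
    have henorm : ∀ {α : Type} (u : α → ℝ) (x : α),
        ‖u x‖ₑ ^ s.toReal = ENNReal.ofReal (|u x| ^ s.toReal) := by
      intro α u x
      rw [← ofReal_norm, ENNReal.ofReal_rpow_of_nonneg (norm_nonneg _) hsr.le, Real.norm_eq_abs]
    have hpow : ∀ y : Fin n → ℝ, abs (∏ i, |f (y i)|) ^ s.toReal = ∏ i, |f (y i)| ^ s.toReal := by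
      intro y
      rw [abs_of_nonneg (Finset.prod_nonneg fun _ _ => abs_nonneg _),
        ← Real.finsetProd_rpow _ _ fun _ _ => abs_nonneg _]
    have hkey : ∫⁻ ξ : Rn n, ‖∏ i, |f (ξ i)|‖ₑ ^ s.toReal
        = (∫⁻ t, ‖f t‖ₑ ^ s.toReal) ^ n := by
      have h1 := hmp.lintegral_comp_emb
        (MeasurableEquiv.toLp 2 (Fin n → ℝ)).symm.measurableEmbedding
        (fun y : Fin n → ℝ => ‖∏ i, |f (y i)|‖ₑ ^ s.toReal)
      refine h1.trans ?_
      simp only [henorm (fun y : Fin n → ℝ => ∏ i, |f (y i)|), henorm f, hpow]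
      rw [← ofReal_integral_eq_lintegral_ofReal
          (μ := (volume : Measure (Fin n → ℝ)))
          (Integrable.fintype_prod (f := fun _ => fun t => |f t| ^ s.toReal) fun _ => hint)
          (Filter.Eventually.of_forall fun y => Finset.prod_nonneg fun _ _ => by positivity),
        ← ofReal_integral_eq_lintegral_ofReal hint
          (Filter.Eventually.of_forall fun y => by positivity),
        integral_fintype_prod_volume_eq_pow (fun t => |f t| ^ s.toReal), Fintype.card_fin,
        ENNReal.ofReal_pow (integral_nonneg fun t => by positivity)]
    rw [eLpNorm_eq_lintegral_rpow_enorm_toReal hs0 hs',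
      eLpNorm_eq_lintegral_rpow_enorm_toReal hs0 hs', hkey, ← ENNReal.rpow_natCast,
      ← ENNReal.rpow_natCast, ← ENNReal.rpow_mul, ← ENNReal.rpow_mul, mul_comm]

/-- The prefactor gives `c` and the change of variables `c^(-1/s)`. With `s = q'` the resulting
power is `c^(1/q)`, the source of `(2R)^(n/q)`. -/
theorem eLpNorm_scaled_sinc {s : ℝ≥0∞} {c : ℝ} (hc : 0 < c) :
    eLpNorm (fun t : ℝ => c * Real.sinc (Real.pi * (c * t))) s volume
      = ENNReal.ofReal (c ^ (1 - (1 / s).toReal)) * sincConst s := by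
  have hemb : MeasurableEmbedding (fun t : ℝ => c * t) :=
    (Homeomorph.mulLeft₀ c hc.ne').measurableEmbedding
  have h1 : eLpNorm (fun t : ℝ => Real.sinc (Real.pi * (c * t))) s volume
      = ENNReal.ofReal (c⁻¹ ^ (1 / s).toReal) * sincConst s := by
    have h2 := hemb.eLpNorm_map_measure (μ := volume)
      (g := fun t : ℝ => Real.sinc (Real.pi * t)) (p := s)
    rw [Real.map_volume_mul_left hc.ne', eLpNorm_smul_measure_of_ne_zero
      (by simpa using hc.ne')] at h2
    rw [abs_of_pos (inv_pos.2 hc),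
      ENNReal.ofReal_rpow_of_nonneg (inv_pos.2 hc).le ENNReal.toReal_nonneg] at h2
    exact h2.symm
  have h3 := eLpNorm_const_smul c (fun t : ℝ => Real.sinc (Real.pi * (c * t))) s volume
  have h4 : (c • fun t : ℝ => Real.sinc (Real.pi * (c * t)))
      = fun t : ℝ => c * Real.sinc (Real.pi * (c * t)) := rfl
  rw [h4] at h3
  rw [h3, h1, ← mul_assoc, ← ofReal_norm, Real.norm_of_nonneg hc.le,
    ← ENNReal.ofReal_mul hc.le]
  congr 2
  simp only [one_div]
  rw [Real.inv_rpow hc.le, Real.rpow_sub hc, Real.rpow_one, div_eq_mul_inv]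

theorem one_div_conjExponent_toReal {q : ℝ≥0∞} (hq : 1 ≤ q) :
    (1 / q.conjExponent).toReal = 1 - 1 / q.toReal := by
  have h : q.HolderConjugate q.conjExponent := .conjExponent hq
  have h1 : q⁻¹ + q.conjExponent⁻¹ = 1 := by
    simpa using ENNReal.HolderTriple.inv_add_inv_eq_inv q q.conjExponent 1
  have h2 := congrArg ENNReal.toReal h1
  have h3 : q⁻¹ ≠ ∞ := fun h => by simp [h] at h1
  have h4 : q.conjExponent⁻¹ ≠ ∞ := fun h => by simp [h] at h1
  rw [ENNReal.toReal_add h3 h4, ENNReal.toReal_inv, ENNReal.toReal_one] at h2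
  rw [one_div, one_div]
  linarith

theorem eLpNorm_prod_sinc_le (n : ℕ) {q : ℝ≥0∞} (hq : 1 ≤ q) (hq' : q ≠ ∞) {ρ : ℝ} (hρ : 0 < ρ) :
    eLpNorm (fun ξ : Rn n => ∏ i, |2 * ρ * Real.sinc (Real.pi * (2 * ρ * ξ i))|)
        q.conjExponent volume
      ≤ sincConst q.conjExponent ^ n * ENNReal.ofReal ((2 * ρ) ^ ((n : ℝ) / q.toReal)) := by
  have hc : 0 < 2 * ρ := by positivity
  have h1 := eLpNorm_scaled_sinc (s := q.conjExponent) hc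
  rw [one_div_conjExponent_toReal hq, sub_sub_cancel] at h1
  have hfin : eLpNorm (fun t : ℝ => 2 * ρ * Real.sinc (Real.pi * (2 * ρ * t)))
      q.conjExponent volume < ∞ := by
    rw [h1]
    exact ENNReal.mul_lt_top ENNReal.ofReal_lt_top
      ((sincConst_conjExponent_le hq hq').trans_lt ENNReal.ofReal_lt_top)
  have hcont : Continuous fun t : ℝ => 2 * ρ * Real.sinc (Real.pi * (2 * ρ * t)) :=
    continuous_const.mul (Real.continuous_sinc.comp (by fun_prop))
  have hs : 1 ≤ q.conjExponent := by simp [ENNReal.conjExponent]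
  have h2 := eLpNorm_prod_coord_le n hs ⟨hcont.aestronglyMeasurable, hfin⟩
  rw [h1] at h2
  refine h2.trans_eq ?_
  rw [mul_pow, mul_comm, ← ENNReal.ofReal_pow (by positivity), ← Real.rpow_natCast,
    ← Real.rpow_mul hc.le]
  rw [one_div_mul_eq_div]

/-! ### Multiplication by the cutoff as convolution -/

variable {n : ℕ}

theorem integral_fourier_mul_eq {f g : Rn n → ℂ} (hf : Integrable f) (hg : Integrable g) :
    ∫ x, 𝓕 f x * g x = ∫ x, f x * 𝓕 g x := by
  have h := VectorFourier.integral_fourierIntegral_smul_eq_flip (μ := volume) (ν := volume)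
    (L := innerₗ (Rn n)) Real.continuous_fourierChar continuous_inner hf hg
  rw [flip_innerₗ] at h
  exact h

/-- Modulating `ψ` translates its transform; the multiplication formula then moves the transform off
`a`. -/
theorem fourier_fourier_mul (a ψ : 𝓢(Rn n, ℂ)) (x : Rn n) :
    𝓕 (fun z => (𝓕 a) z * ψ z) x = ∫ y, a (y - x) * (𝓕 ψ) y := by
  have h1 := integral_fourier_mul_eq a.integrable
    (g := fun z => Real.fourierChar (-inner ℝ z x) • ψ z)
    ((Real.fourierIntegral_convergent_iff x).2 ψ.integrable)
  have h2 : ∀ t, 𝓕 (fun z => Real.fourierChar (-inner ℝ z x) • ψ z) t = (𝓕 ψ) (t + x) := by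
    intro t
    rw [SchwartzMap.fourier_coe, Real.fourier_eq, Real.fourier_eq]
    refine integral_congr_ae (Filter.Eventually.of_forall fun z => ?_)
    simp only [inner_add_right, neg_add, AddChar.map_add_eq_mul, smul_smul]
  have h3 := integral_sub_right_eq_self (μ := volume) (fun t => a t * (𝓕 ψ) (t + x)) x
  simp only [sub_add_cancel] at h3
  simp only [h2] at h1
  rw [h3, ← h1, Real.fourier_eq]
  refine integral_congr_ae (Filter.Eventually.of_forall fun z => ?_)
  simp only [Circle.smul_def, smul_eq_mul, SchwartzMap.fourier_coe]
  ring

/-- Testing the relation between `h` and `g` on the Schwartz function `𝓕 a * ψ` and exchanging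
integrals gives the claim. Fubini is justified by the `∞` case of Young: the integral in `x` is
bounded uniformly in `y`, and `𝓕 ψ` is integrable. -/
theorem isFourierOf_mul_fourier {p : ℝ≥0∞} (hp : 1 ≤ p) {h g : Rn n → ℂ} (hg : MemLp g p)
    (hhg : IsFourierOf h g) (a : 𝓢(Rn n, ℂ)) :
    IsFourierOf (fun x => h x * (𝓕 a) x) (fun y => ∫ x, g x * a (y - x)) := by
  intro ψ
  have hpc : p.HolderConjugate p.conjExponent := .conjExponent hp
  have h1 := hhg (SchwartzMap.pairing (ContinuousLinearMap.mul ℂ ℂ) (𝓕 a) ψ)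
  have h2 : ∀ x, (𝓕 (SchwartzMap.pairing (ContinuousLinearMap.mul ℂ ℂ) (𝓕 a) ψ)) x
      = ∫ y, a (y - x) * (𝓕 ψ) y := by
    intro x
    rw [← fourier_fourier_mul, SchwartzMap.fourier_coe]
    rfl
  simp only [h2, SchwartzMap.pairing_apply_apply, ContinuousLinearMap.mul_apply'] at h1
  simp only [mul_assoc]
  rw [h1]
  have hsub : Measure.QuasiMeasurePreserving (fun z : Rn n × Rn n => z.2 - z.1)
      (volume.prod volume) volume := by
    exact (quasiMeasurePreserving_sub_of_right_invariant volume volume).comp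
      Measure.measurePreserving_swap.quasiMeasurePreserving
  have hm : AEStronglyMeasurable (Function.uncurry fun x y => g x * (a (y - x) * (𝓕 ψ) y))
      (volume.prod volume) :=
    hg.1.comp_fst.mul ((a.continuous.comp (continuous_snd.sub continuous_fst)).mul
      ((𝓕 ψ).continuous.comp continuous_snd)).aestronglyMeasurable
  have hi : Integrable (Function.uncurry fun x y => g x * (a (y - x) * (𝓕 ψ) y))
      (volume.prod volume) := by
    refine ⟨hm, ?_⟩
    rw [hasFiniteIntegral_iff_enorm, lintegral_prod_symm _ hm.enorm]
    calc _ ≤ ∫⁻ y, eLpNorm g p volume * eLpNorm a p.conjExponent volume * ‖(𝓕 ψ) y‖ₑ := by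
          refine lintegral_mono fun y => ?_
          simp only [Function.uncurry_apply_pair, enorm_mul, ← mul_assoc]
          rw [lintegral_mul_const' _ _ enorm_ne_top]
          gcongr
          exact lintegral_enorm_mul_enorm_sub_le hg.1 a.continuous.aestronglyMeasurable y
      _ < ∞ := by
          rw [lintegral_const_mul' _ _ (ENNReal.mul_ne_top hg.2.ne (a.memLp _ _).2.ne)]
          exact ENNReal.mul_lt_top (ENNReal.mul_lt_top hg.2 (a.memLp _ _).2)
            (𝓕 ψ).integrable.2
  simp only [← integral_const_mul, ← integral_mul_const]
  rw [integral_integral_swap hi]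
  simp only [mul_assoc]

theorem memLp_convolution {p s r : ℝ≥0∞} (hp : 1 ≤ p) (hs : 1 ≤ s)
    (hprs : p⁻¹ + s⁻¹ = 1 + r⁻¹) {g a : Rn n → ℂ} (hg : MemLp g p) (ha : MemLp a s) :
    MemLp (fun y => ∫ x, g x * a (y - x)) r := by
  refine ⟨?_, (eLpNorm_convolution_le hp hs hprs hg.1 ha.1).trans_lt
    (ENNReal.mul_lt_top hg.2 ha.2)⟩
  have hm : AEStronglyMeasurable (fun z : Rn n × Rn n => g z.2 * a (z.1 - z.2))
      (volume.prod volume) :=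
    hg.1.comp_snd.mul (ha.1.comp_quasiMeasurePreserving
      (quasiMeasurePreserving_sub_of_right_invariant volume volume))
  exact hm.integral_prod_right'

/-! ### Testing measures and the norm inequality -/

theorem SFMeasure.absIntegral_const_mul (μ : SFMeasure n) {c : ℂ} (hc : c ≠ 0) (h : Rn n → ℂ) :
    μ.absIntegral (fun x => c * h x) = ‖c‖ₑ * μ.absIntegral h := by
  have hiff : Integrable (fun x => c * h x) μ.variation ↔ Integrable h μ.variation :=
    integrable_const_mul_iff (IsUnit.mk0 c hc) h
  unfold SFMeasure.absIntegral
  by_cases hi : Integrable h μ.variation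
  · rw [if_pos hi, if_pos (hiff.2 hi)]
    simp only [mul_assoc, integral_const_mul, enorm_mul]
  · rw [if_neg hi, if_neg (mt hiff.1 hi), ENNReal.mul_top (by simpa using hc)]

theorem SFMeasure.absIntegral_restrict_congr (μ : SFMeasure n) {E : Set (Rn n)}
    (hE : MeasurableSet E) {h k : Rn n → ℂ} (hk : Set.EqOn h k E) :
    (μ.restrict E).absIntegral h = (μ.restrict E).absIntegral k := by
  have hae : h =ᵐ[μ.variation.restrict E] k :=
    (ae_restrict_iff' hE).2 (Filter.Eventually.of_forall hk)
  have hi : Integrable h (μ.restrict E).variation ↔ Integrable k (μ.restrict E).variation :=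
    integrable_congr hae
  have hint : ∫ x, h x * (μ.restrict E).phase x ∂(μ.restrict E).variation
      = ∫ x, k x * (μ.restrict E).phase x ∂(μ.restrict E).variation :=
    integral_congr_ae (hae.mono fun x hx => by simp only [hx])
  unfold SFMeasure.absIntegral
  rw [hint]
  by_cases h' : Integrable h (μ.restrict E).variation
  · rw [if_pos h', if_pos (hi.1 h')]
  · rw [if_neg h', if_neg (mt hi.2 h')]

theorem conjExponent_conjExponent {p : ℝ≥0∞} (hp : 1 ≤ p) :
    p.conjExponent.conjExponent = p := by
  have h : p.HolderConjugate p.conjExponent := .conjExponent hp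
  have h' : p.conjExponent.HolderConjugate p := h.symm
  exact ENNReal.HolderConjugate.conjExponent_eq

/-- `h / C` is an admissible test function: the hat norm is an infimum, so one representing `g` with
a norm bound suffices. -/
theorem SFMeasure.absIntegral_le (μ : SFMeasure n) {r : ℝ≥0∞} (hr : 1 ≤ r) {h g : Rn n → ℂ}
    (hc : Continuous h) (hh : MemLp h r.conjExponent) (hg : MemLp g r) (hhg : IsFourierOf h g)
    {C : ℝ} (hC : 0 < C) (hgC : eLpNorm g r volume ≤ ENNReal.ofReal C) :
    μ.absIntegral h ≤ ENNReal.ofReal C * μ.starNorm r := by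
  have hC' : ((C⁻¹ : ℝ) : ℂ) ≠ 0 := by simpa using hC.ne'
  set c : ℂ := ((C⁻¹ : ℝ) : ℂ) with hcdef
  have hcn : ‖c‖ₑ = (ENNReal.ofReal C)⁻¹ := by
    rw [← ofReal_norm, hcdef, Complex.norm_real, Real.norm_of_nonneg (by positivity),
      ENNReal.ofReal_inv_of_pos hC]
  have hF : IsFourierOf (fun x => c * h x) (fun x => c * g x) := by
    intro ψ
    simp only [mul_assoc, integral_const_mul]
    rw [hhg ψ]
  have hgm : MemLp (fun x => c * g x) r.conjExponent.conjExponent := by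
    rw [conjExponent_conjExponent hr]; exact hg.const_mul c
  have hnorm : hatLpNorm r.conjExponent (fun x => c * h x) ≤ 1 := by
    refine (iInf₂_le (fun x => c * g x) ⟨hgm, hF⟩).trans ?_
    rw [conjExponent_conjExponent hr]
    have := eLpNorm_const_smul c g r volume
    change eLpNorm (c • g) r volume ≤ 1
    rw [this, hcn]
    calc _ ≤ (ENNReal.ofReal C)⁻¹ * ENNReal.ofReal C := by gcongr
      _ ≤ 1 := ENNReal.inv_mul_le_one _
  have hle : μ.absIntegral (fun x => c * h x) ≤ μ.starNorm r :=
    le_iSup₂_of_le (fun x => c * h x) ⟨continuous_const.mul hc, ⟨hh.const_mul c, _, hgm, hF⟩, hnorm⟩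
      le_rfl
  rw [μ.absIntegral_const_mul hC', hcn] at hle
  rwa [ENNReal.inv_mul_le_iff (by simpa using hC) ENNReal.ofReal_ne_top] at hle

/-- Testing on smooth compactly supported functions gives `h = 𝓕 g` almost everywhere, and
continuity upgrades this to every point. The pointwise form is needed because `μ` may charge null
sets. -/
theorem enorm_le_eLpNorm_one {h g : Rn n → ℂ} (hc : Continuous h) (hg : MemLp g 1)
    (hhg : IsFourierOf h g) (x : Rn n) : ‖h x‖ₑ ≤ eLpNorm g 1 volume := by
  have hgi : Integrable g := memLp_one_iff_integrable.1 hg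
  have hgc : Continuous (𝓕 g) :=
    VectorFourier.fourierIntegral_continuous Real.continuous_fourierChar continuous_inner hgi
  have hae : h =ᵐ[volume] 𝓕 g := by
    refine ae_eq_of_integral_contDiff_smul_eq hc.locallyIntegrable hgc.locallyIntegrable ?_
    intro u hu hus
    let ψ : 𝓢(Rn n, ℂ) := (hus.comp_left (g := Complex.ofReal) Complex.ofReal_zero).toSchwartzMap
      (Complex.ofRealCLM.contDiff.comp hu)
    have hψ : ∀ x, ψ x = u x := fun x => rfl
    have h1 := hhg ψ
    have h2 := integral_fourier_mul_eq hgi ψ.integrable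
    rw [← SchwartzMap.fourier_coe, ← h1] at h2
    simp only [hψ] at h2
    simpa only [Complex.real_smul, mul_comm] using h2.symm
  have heq : h = 𝓕 g := (hc.ae_eq_iff_eq volume hgc).1 hae
  rw [heq, eLpNorm_one_eq_lintegral_enorm, ← ofReal_integral_norm_eq_lintegral_enorm hgi,
    ← ofReal_norm]
  exact ENNReal.ofReal_le_ofReal (VectorFourier.norm_fourierIntegral_le_integral_norm _ _ _ _ _)

theorem sincConst_ne_zero {s : ℝ≥0∞} (hs : s ≠ 0) : sincConst s ≠ 0 := by
  intro h
  have hc : Continuous fun t : ℝ => Real.sinc (Real.pi * t) :=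
    Real.continuous_sinc.comp (by fun_prop)
  rw [sincConst, eLpNorm_eq_zero_iff hc.aestronglyMeasurable hs] at h
  have h0 : Real.sinc (Real.pi * 0) = (0 : ℝ) :=
    congrFun ((hc.ae_eq_iff_eq volume continuous_const).1 h) 0
  simp at h0

theorem SFMeasure.starNormOn_le (μ : SFMeasure n) {p r q : ℝ≥0∞} (hp : 1 ≤ p) (hr : 1 ≤ r)
    (hq : 1 ≤ q) (hq' : q ≠ ∞) (h : 1 / q + 1 / r = 1 / p) {R : ℝ} (hR : 0 < R) {E : Set (Rn n)}
    (hE : MeasurableSet E) (hER : E ⊆ cube n R) :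
    μ.starNormOn p E ≤ sincConst q.conjExponent ^ n *
      ENNReal.ofReal ((2 * R) ^ ((n : ℝ) / q.toReal)) * μ.starNormOn r E := by
  have hs : 1 ≤ q.conjExponent := by simp [ENNReal.conjExponent]
  set S := sincConst q.conjExponent with hS
  set e := (n : ℝ) / q.toReal with he
  have hS0 : S ^ n ≠ 0 := pow_ne_zero _ (sincConst_ne_zero (zero_lt_one.trans_le hs).ne')
  have hST : S ^ n ≠ ∞ := ENNReal.pow_ne_top
    ((sincConst_conjExponent_le hq hq').trans_lt ENNReal.ofReal_lt_top).ne
  have hprs : p⁻¹ + q.conjExponent⁻¹ = 1 + r⁻¹ := by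
    have hqq : q.HolderConjugate q.conjExponent := .conjExponent hq
    have h1 : q⁻¹ + q.conjExponent⁻¹ = 1 := by
      simpa using ENNReal.HolderTriple.inv_add_inv_eq_inv q q.conjExponent 1
    simp only [one_div] at h
    rw [← h, ← h1]; ring
  refine iSup₂_le fun k hk => ?_
  obtain ⟨hkc, ⟨hkm, -⟩, hkn⟩ := hk
  have key : ∀ ε > 0, (μ.restrict E).absIntegral k
      ≤ S ^ n * ENNReal.ofReal ((1 + ε) * (2 * (R + ε)) ^ e) * μ.starNormOn r E := by
    intro ε hε
    -- The slack `1 + ε` selects a near-minimizing `g`, so neither uniqueness of `g` nor attainment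
    -- of the infimum is needed.
    have hlt : hatLpNorm p.conjExponent k < ENNReal.ofReal (1 + ε) := by
      refine hkn.trans_lt ?_
      rw [← ENNReal.ofReal_one]
      exact (ENNReal.ofReal_lt_ofReal_iff (by positivity)).2 (by linarith)
    obtain ⟨g, hg⟩ := iInf_lt_iff.1 hlt
    obtain ⟨⟨hgm, hgF⟩, hgn⟩ := iInf_lt_iff.1 hg
    rw [conjExponent_conjExponent hp] at hgm hgn
    obtain ⟨a, has, ha1, hab⟩ := exists_cutoff n hR.le hε
    have haS : eLpNorm a q.conjExponent volume ≤ S ^ n * ENNReal.ofReal ((2 * (R + ε)) ^ e) :=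
      (eLpNorm_mono_real hab).trans (eLpNorm_prod_sinc_le n hq hq' (by positivity))
    have hG := memLp_convolution hp hs hprs hgm (a.memLp q.conjExponent volume)
    have hGn : eLpNorm (fun y => ∫ x, g x * a (y - x)) r volume
        ≤ S ^ n * ENNReal.ofReal ((1 + ε) * (2 * (R + ε)) ^ e) := by
      refine (eLpNorm_convolution_le hp hs hprs hgm.1 a.continuous.aestronglyMeasurable).trans ?_
      refine (mul_le_mul' hgn.le haS).trans_eq ?_
      rw [ENNReal.ofReal_mul (by positivity)]
      ring
    have hkc' : Continuous fun x => k x * (𝓕 a : 𝓢(Rn n, ℂ)) x := hkc.mul (𝓕 a).continuous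
    -- Membership in `L^{r'}` comes from continuity and compact support alone.
    have hk' := hkc'.memLp_of_hasCompactSupport (p := r.conjExponent) (μ := volume) has.mul_left
    have heq : Set.EqOn k (fun x => k x * (𝓕 a : 𝓢(Rn n, ℂ)) x) E := fun x hx => by
      simp [ha1 x (hER hx)]
    have hCT : S ^ n * ENNReal.ofReal ((1 + ε) * (2 * (R + ε)) ^ e) ≠ ∞ :=
      ENNReal.mul_ne_top hST ENNReal.ofReal_ne_top
    have hC0 : S ^ n * ENNReal.ofReal ((1 + ε) * (2 * (R + ε)) ^ e) ≠ 0 :=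
      mul_ne_zero hS0 (ENNReal.ofReal_pos.2 (by positivity)).ne'
    rw [μ.absIntegral_restrict_congr hE heq, ← ENNReal.ofReal_toReal hCT]
    exact (μ.restrict E).absIntegral_le hr hkc' hk' hG (isFourierOf_mul_fourier hp hgm hgF a)
      (ENNReal.toReal_pos hC0 hCT) (by rwa [ENNReal.ofReal_toReal hCT])
  have hlim : Filter.Tendsto (fun ε : ℝ => (1 + ε) * (2 * (R + ε)) ^ e) (nhdsWithin 0 (Set.Ioi 0))
      (nhds ((2 * R) ^ e)) := by
    have hc : ContinuousAt (fun ε : ℝ => (1 + ε) * (2 * (R + ε)) ^ e) 0 :=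
      (continuousAt_const.add continuousAt_id).mul
        (ContinuousAt.rpow_const (by fun_prop) (Or.inl (by simpa using hR.ne')))
    have := hc.tendsto.mono_left (nhdsWithin_le_nhds (s := Set.Ioi 0))
    simpa using this
  -- The norm for `r` may be `∞`; the limit then passes through the product because the limiting
  -- constant is nonzero.
  have hlim' := ENNReal.Tendsto.mul_const (b := μ.starNormOn r E)
    (ENNReal.Tendsto.const_mul (a := S ^ n) (ENNReal.tendsto_ofReal hlim) (Or.inr hST))
    (Or.inl (mul_ne_zero hS0 (ENNReal.ofReal_pos.2 (by positivity)).ne'))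
  exact ge_of_tendsto hlim' (eventually_nhdsWithin_of_forall fun ε hε => key ε hε)

/-! ### Consequences for bounded sets -/

theorem exists_subset_cube {E : Set (Rn n)} (hE : Bornology.IsBounded E) :
    ∃ R : ℝ, 0 < R ∧ E ⊆ cube n R := by
  obtain ⟨R, hR, h⟩ := hE.exists_pos_norm_le
  exact ⟨R, hR, fun x hx i => abs_le.1 ((PiLp.norm_apply_le x i).trans (h x hx))⟩

theorem exponent_bounds {p r q : ℝ≥0∞} (hp : 1 ≤ p) (hpr : p < r) (h : 1 / q + 1 / r = 1 / p) :
    1 ≤ q ∧ q ≠ ∞ := by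
  simp only [one_div] at h
  refine ⟨?_, ?_⟩
  · rw [← ENNReal.inv_le_one]
    exact le_self_add.trans (h.trans_le (ENNReal.inv_le_one.2 hp))
  · rintro rfl
    simp only [ENNReal.inv_top, zero_add, inv_inj] at h
    exact hpr.ne' h

theorem MpOn_subset_MpOn {E : Set (Rn n)} (hE : MeasurableSet E) (hEb : Bornology.IsBounded E)
    {p r : ℝ≥0∞} (hp : 1 ≤ p) (hpr : p ≤ r) : MpOn r E ⊆ MpOn p E := by
  intro μ hμ
  rcases hpr.eq_or_lt with rfl | hlt
  · exact hμ
  have h : 1 / (p⁻¹ - r⁻¹)⁻¹ + 1 / r = 1 / p := by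
    simp only [one_div, inv_inv]
    exact tsub_add_cancel_of_le (ENNReal.inv_le_inv.2 hpr)
  obtain ⟨hq, hq'⟩ := exponent_bounds hp hlt h
  obtain ⟨R, hR, hER⟩ := exists_subset_cube hEb
  refine (μ.starNormOn_le hp (hp.trans hpr) hq hq' h hR hE hER).trans_lt ?_
  exact ENNReal.mul_lt_top (ENNReal.mul_lt_top (ENNReal.pow_lt_top
    ((sincConst_conjExponent_le hq hq').trans_lt ENNReal.ofReal_lt_top)) ENNReal.ofReal_lt_top) hμ

theorem SFMeasure.variation_lt_top_of_isBounded {μ : SFMeasure n} {p : ℝ≥0∞} (hp : 1 ≤ p)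
    (hμ : μ ∈ Mp n p) {E : Set (Rn n)} (hEb : Bornology.IsBounded E) : μ.variation E < ∞ := by
  obtain ⟨R, hR, hER⟩ := exists_subset_cube hEb
  obtain ⟨a, has, ha1, -⟩ := exists_cutoff n hR.le one_pos
  have hF : IsFourierOf (𝓕 a : 𝓢(Rn n, ℂ)) a := by
    intro ψ
    have := integral_fourier_mul_eq a.integrable ψ.integrable
    simpa only [SchwartzMap.fourier_coe] using this
  have ham := a.memLp p volume
  have hle := μ.absIntegral_le hp (𝓕 a).continuous ((𝓕 a).memLp p.conjExponent volume) ham hF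
    (C := (eLpNorm a p volume).toReal + 1) (by positivity)
    (by
      rw [ENNReal.ofReal_add ENNReal.toReal_nonneg zero_le_one, ENNReal.ofReal_toReal ham.2.ne]
      exact le_self_add)
  -- A non-integrable test function counts as `∞`, which a finite `‖μ‖_p^*` rules out.
  have hint : Integrable (𝓕 a : 𝓢(Rn n, ℂ)) μ.variation := by
    by_contra hni
    rw [SFMeasure.absIntegral, if_neg hni] at hle
    exact absurd (top_le_iff.1 hle) (ENNReal.mul_lt_top ENNReal.ofReal_lt_top hμ).ne
  calc μ.variation E ≤ μ.variation {x | (1 : ℝ) ≤ ‖(𝓕 a : 𝓢(Rn n, ℂ)) x‖} :=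
        measure_mono fun x hx => by simp [ha1 x (hER hx)]
    _ < ∞ := hint.measure_norm_ge_lt_top one_pos

theorem Mp_subset_M1loc {p : ℝ≥0∞} (hp : 1 ≤ p) : Mp n p ⊆ M1loc n := by
  intro μ hμ E _ hEb
  have hfin := SFMeasure.variation_lt_top_of_isBounded hp hμ hEb
  refine lt_of_le_of_lt (b := 2 * μ.variation E) (iSup₂_le fun k hk => ?_)
    (ENNReal.mul_lt_top ENNReal.ofNat_lt_top hfin)
  obtain ⟨hkc, -, hkn⟩ := hk
  -- Any number above 1 would serve in place of 2; only finiteness matters.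
  obtain ⟨g, hg⟩ := iInf_lt_iff.1 (hkn.trans_lt (show (1 : ℝ≥0∞) < 2 by norm_num))
  obtain ⟨⟨hgm, hgF⟩, hgn⟩ := iInf_lt_iff.1 hg
  rw [conjExponent_conjExponent le_rfl] at hgm hgn
  have hb : ∀ x, ‖k x‖ₑ ≤ 2 := fun x => (enorm_le_eLpNorm_one hkc hgm hgF x).trans hgn.le
  have hl : ∫⁻ x in E, ‖k x‖ₑ ∂μ.variation ≤ 2 * μ.variation E := by
    calc _ ≤ ∫⁻ _ in E, 2 ∂μ.variation := lintegral_mono hb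
      _ = _ := setLIntegral_const _ _
  have hi : Integrable k (μ.restrict E).variation :=
    ⟨hkc.aestronglyMeasurable, hl.trans_lt (ENNReal.mul_lt_top ENNReal.ofNat_lt_top hfin)⟩
  rw [SFMeasure.absIntegral, if_pos hi]
  refine (enorm_integral_le_lintegral_enorm _).trans (le_trans (le_of_eq ?_) hl)
  refine lintegral_congr fun x => ?_
  have h1 : ‖(μ.restrict E).phase x‖ₑ = 1 := by
    rw [← ofReal_norm, (μ.restrict E).norm_phase, ENNReal.ofReal_one]
  rw [enorm_mul, h1, mul_one]

end MeasLp

theorem mainTheorem8 (n : ℕ) :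
    (∀ E : Set (MeasLp.Rn n), MeasurableSet E → Bornology.IsBounded E →
      ∀ p r : ℝ≥0∞, 1 ≤ p → p ≤ r → MeasLp.MpOn r E ⊆ MeasLp.MpOn p E) ∧
    (∀ p r q : ℝ≥0∞, 1 ≤ p → p < r → 1 / q + 1 / r = 1 / p →
      MeasLp.sincConst q.conjExponent
          ≤ ENNReal.ofReal ((2 * q.toReal / Real.pi) ^ (1 - 1 / q.toReal)) ∧
      ∀ R : ℝ, 0 < R → ∀ E : Set (MeasLp.Rn n), MeasurableSet E → E ⊆ MeasLp.cube n R →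
        ∀ μ : MeasLp.SFMeasure n,
          μ.starNormOn p E ≤ MeasLp.sincConst q.conjExponent ^ n *
            ENNReal.ofReal ((2 * R) ^ ((n : ℝ) / q.toReal)) * μ.starNormOn r E) ∧
    (∀ p : ℝ≥0∞, 1 ≤ p → MeasLp.Mp n p ⊆ MeasLp.M1loc n) := by
  refine ⟨fun E hE hEb p r hp hpr => MeasLp.MpOn_subset_MpOn hE hEb hp hpr,
    fun p r q hp hpr h => ?_, fun p hp => MeasLp.Mp_subset_M1loc hp⟩
  obtain ⟨hq, hq'⟩ := MeasLp.exponent_bounds hp hpr h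
  exact ⟨MeasLp.sincConst_conjExponent_le hq hq', fun R hR E hE hER μ =>
    μ.starNormOn_le hp (hp.trans hpr.le) hq hq' h hR hE hER⟩
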